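/- For $n \ge 0$ let $\gamma_n$ be the standard Gaussian measure on $\mathbb{R}^n$, and for $t > 0$ and bounded measurable $f : \mathbb{R}^n \to \mathbb{R}$ let $$P_t f(x) = \mathbb{E}\, f\bigl(e^{-t} x + \sqrt{1-e^{-2t}}\, X\bigr), \qquad X \sim \gamma_n,$$ be the Ornstein--Uhlenbeck semigroup. A sequence of measurable sets $A_i \subset \mathbb{R}^{n_i}$ is called noise sensitive if $\operatorname{Var}(P_t 1_{A_i}) \to 0$ as $i \to \infty$ for every $t > 0$ (the variance being taken with respect to $\gamma_{n_i}$), and noise stable if it is not noise sensitive. Let $B_n = \{x \in \mathbb{R}^n : |x| \le \sqrt n\}$ be the Euclidean ball of radius $\sqrt n$. **Proposition.** There is a sequence $(\varepsilon_n)$ of real numbers, not depending on $t$, with $\varepsilon_n \to 0$ as $n \to \infty$, such that for every $n$ and every $t > 0$ $$\operatorname{Var}(P_t 1_{B_n}) \ \ge\ \frac14 - \frac{\arccos(e^{-2t})}{\sqrt 2\,\pi} - \varepsilon_n .$$ In particular, the sequence $(B_n)$ is noise stable. -/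

import Mathlib

open MeasureTheory ProbabilityTheory Filter Topology

noncomputable section

/-- The standard Gaussian measure `γ_n` on `ℝⁿ` with its Euclidean structure. -/
def gaussianMeasure (n : ℕ) : Measure (EuclideanSpace ℝ (Fin n)) :=
  stdGaussian (EuclideanSpace ℝ (Fin n))

/-- The Ornstein-Uhlenbeck semigroup
`P_t f (x) = 𝔼 f (e^{-t} x + √(1 - e^{-2t}) X)`, where `X` has law `γ_n`. -/
def ornsteinUhlenbeck {n : ℕ} (t : ℝ) (f : EuclideanSpace ℝ (Fin n) → ℝ)
    (x : EuclideanSpace ℝ (Fin n)) : ℝ :=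
  ∫ y, f (Real.exp (-t) • x + Real.sqrt (1 - Real.exp (-2 * t)) • y) ∂(gaussianMeasure n)

/-- `Var (P_t 1_A)`, the variance being taken with respect to `γ_n`. -/
def noiseVariance {n : ℕ} (t : ℝ) (A : Set (EuclideanSpace ℝ (Fin n))) : ℝ :=
  variance (ornsteinUhlenbeck t (A.indicator fun _ => (1 : ℝ))) (gaussianMeasure n)

/-- A sequence of sets `A i ⊆ ℝ^{d i}` is noise sensitive if `Var (P_t 1_{A i}) → 0`
for every `t > 0`. -/
def GaussianNoiseSensitive {d : ℕ → ℕ} (A : ∀ i, Set (EuclideanSpace ℝ (Fin (d i)))) : Prop :=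
  ∀ t : ℝ, 0 < t → Tendsto (fun i => noiseVariance t (A i)) atTop (𝓝 0)

/-- A sequence of sets is noise stable if it is not noise sensitive. -/
def GaussianNoiseStable {d : ℕ → ℕ} (A : ∀ i, Set (EuclideanSpace ℝ (Fin (d i)))) : Prop :=
  ¬ GaussianNoiseSensitive A

/-- The Euclidean ball `B_n` of radius `√n` in `ℝⁿ`, centred at the origin. -/
def sqrtBall (n : ℕ) : Set (EuclideanSpace ℝ (Fin n)) :=
  Metric.closedBall 0 (Real.sqrt n)

end

/-! Let `X`, `Y` be independent standard Gaussians and `cos θ = e^{-2t}`. Two noisy copies of one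
Gaussian vector have the law of `(X, cos θ X + sin θ Y)`, so `noiseVariance_eq` gives `Var (P_t 1_A)
= γ(A) - γ(A)² - ½ P(crossing)`, a crossing meaning that exactly one of the two points lies in `A`.

For a `C¹` function `f`, rotation invariance gives `E|f(X_θ) - f(X)| ≤ θ E|∇f(X)·Y| = θ √(2/π)
E|∇f(X)|` (`lintegral_enorm_sub_rotation_le`). Take `f` to be a ramp of width `δ` in `Z = (|x|² -
n)/√(2n)`. Its gradient has norm about `√2` times the ramp slope, and by the central limit theorem
the mean slope has limit at most `1/√(2π)`. Half the crossing probability is thus at most about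
`θ/(√2 π)`, plus the mass of `0 ≤ Z ≤ δ`, which tends to at most `δ`. Also `γ(B_n) → 1/2`, which
yields the `1/4`. Since `θ ≤ π/2`, all errors are uniform in `t`. -/

/-! ### Rotations of Gaussian pairs -/

section GaussianSpace

variable {E : Type*} [NormedAddCommGroup E] [InnerProductSpace ℝ E] [FiniteDimensional ℝ E]
  [MeasurableSpace E] [BorelSpace E]

/-- The second component is the `θ`-derivative of the first, so position and velocity along the
rotation path stay an independent standard pair. -/
lemma measurePreserving_rotation_stdGaussian (θ : ℝ) :
    MeasurePreserving (fun p : E × E => (Real.cos θ • p.1 + Real.sin θ • p.2,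
        -Real.sin θ • p.1 + Real.cos θ • p.2))
      ((stdGaussian E).prod (stdGaussian E)) ((stdGaussian E).prod (stdGaussian E)) := by
  refine ⟨by fun_prop, ?_⟩
  have h := IsGaussian.map_rotation_eq_self_of_forall_strongDual_eq_zero
    (integral_strongDual_stdGaussian (E := E)) θ
  convert h using 2
  ext p <;> simp [ContinuousLinearMap.rotation_apply]

lemma measurePreserving_comb_stdGaussian {a b : ℝ} (hab : a ^ 2 + b ^ 2 = 1) :
    MeasurePreserving (fun p : E × E => a • p.1 + b • p.2)
      ((stdGaussian E).prod (stdGaussian E)) (stdGaussian E) := by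
  obtain ⟨θ, rfl, rfl⟩ : ∃ θ, a = Real.cos θ ∧ b = Real.sin θ := by
    refine ⟨Complex.arg ⟨a, b⟩, ?_, ?_⟩
    · have hn : ‖(⟨a, b⟩ : ℂ)‖ = 1 := by
        rw [Complex.norm_eq_sqrt_sq_add_sq]; simp [hab]
      rw [Complex.cos_arg, hn]
      · simp
      · intro h; simp [h] at hn
    · have hn : ‖(⟨a, b⟩ : ℂ)‖ = 1 := by
        rw [Complex.norm_eq_sqrt_sq_add_sq]; simp [hab]
      rw [Complex.sin_arg, hn]; simp
  exact measurePreserving_fst.comp (measurePreserving_rotation_stdGaussian θ)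

/-- Two independent noisy copies of a Gaussian vector form a correlated Gaussian pair. -/
lemma integral_noisy_pair {ρ σ θ : ℝ} (hρσ : ρ ^ 2 + σ ^ 2 = 1) (hσ : 0 < σ)
    (hcos : Real.cos θ = ρ ^ 2) (hsin : 0 ≤ Real.sin θ) {F : E × E → ℝ} (hF : Measurable F) :
    ∫ q : E × (E × E), F (ρ • q.1 + σ • q.2.1, ρ • q.1 + σ • q.2.2)
        ∂((stdGaussian E).prod ((stdGaussian E).prod (stdGaussian E)))
      = ∫ p : E × E, F (p.1, Real.cos θ • p.1 + Real.sin θ • p.2)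
        ∂((stdGaussian E).prod (stdGaussian E)) := by
  have hs2 : Real.sin θ ^ 2 = σ ^ 2 * (1 + ρ ^ 2) := by
    have := Real.sin_sq_add_cos_sq θ
    rw [hcos] at this
    linear_combination this - (1 + ρ ^ 2) * hρσ
  have hspos : 0 < Real.sin θ := by
    rcases hsin.lt_or_eq with h | h
    · exact h
    · rw [← h] at hs2
      have : 0 < σ ^ 2 * (1 + ρ ^ 2) := by positivity
      simp [← hs2] at this
  set s := Real.sin θ
  obtain ⟨φ, hφ1, hφ2⟩ : ∃ φ, ρ = Real.cos φ ∧ σ = Real.sin φ := by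
    refine ⟨Real.arccos ρ, (Real.cos_arccos (by nlinarith) (by nlinarith)).symm, ?_⟩
    rw [Real.sin_arccos, ← hρσ]; simp [Real.sqrt_sq hσ.le]
  have hrot := measurePreserving_rotation_stdGaussian (E := E) φ
  rw [← hφ1, ← hφ2] at hrot
  -- With `U = ρx + σy` and `V = -σx + ρy`, one has `x = ρU - σV`, so the second copy is `ρx + σz =
  -- ρ²U + (-ρσV + σz)`. The bracket is independent of `U`; dividing it by `s` makes it standard, as
  -- `s² = σ²(1 + ρ²)`.
  have hcomb := measurePreserving_comb_stdGaussian (E := E) (a := -(ρ * σ) / s) (b := σ / s)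
    (by field_simp; linear_combination -hs2)
  have hK := ((MeasurePreserving.id (stdGaussian E)).prod hcomb).comp
    ((measurePreserving_prodAssoc (stdGaussian E) (stdGaussian E) (stdGaussian E)).comp
      ((hrot.prod (MeasurePreserving.id (stdGaussian E))).comp
        (measurePreserving_prodAssoc (stdGaussian E) (stdGaussian E) (stdGaussian E)).symm))
  have hG : Measurable (fun p : E × E => F (p.1, Real.cos θ • p.1 + s • p.2)) := by fun_prop
  have hmap := integral_map (μ := (stdGaussian E).prod ((stdGaussian E).prod (stdGaussian E))) hK.measurable.aemeasurable
    hG.aestronglyMeasurable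
  rw [hK.map_eq] at hmap
  rw [hmap]
  apply integral_congr_ae
  filter_upwards with ⟨x, y, z⟩
  have : ρ • x + σ • z = ρ ^ 2 • (ρ • x + σ • y) +
      s • ((-(ρ * σ) / s) • (-σ • x + ρ • y) + (σ / s) • z) := by
    have h1 : s * (-(ρ * σ) / s) = -(ρ * σ) := by field_simp
    have h2 : s * (σ / s) = σ := by field_simp
    rw [smul_add s, smul_smul s, smul_smul s, h1, h2]
    have h3 : ρ = ρ ^ 3 + ρ * σ ^ 2 := by linear_combination -ρ * hρσ
    nth_rw 1 [h3]
    module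
  simp only [Function.comp_apply, MeasurableEquiv.prodAssoc, hcos]
  simpa using congrArg (fun w => F (ρ • x + σ • y, w)) this

/-- A continuously differentiable function varies along a Gaussian rotation by at most its mean
directional derivative times the angle. -/
lemma lintegral_enorm_sub_rotation_le {f : E → ℝ} (hf : ContDiff ℝ 1 f) {θ : ℝ} (hθ : 0 ≤ θ) :
    ∫⁻ p : E × E, ‖f (Real.cos θ • p.1 + Real.sin θ • p.2) - f p.1‖ₑ
        ∂((stdGaussian E).prod (stdGaussian E))
      ≤ ENNReal.ofReal θ * ∫⁻ p : E × E, ‖fderiv ℝ f p.1 p.2‖ₑ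
        ∂((stdGaussian E).prod (stdGaussian E)) := by
  set R : ℝ → E × E → E × E := fun s p =>
    (Real.cos s • p.1 + Real.sin s • p.2, -Real.sin s • p.1 + Real.cos s • p.2) with hR
  have hRc : Continuous (fun q : (E × E) × ℝ => R q.2 q.1) := by fun_prop
  have hfd : Continuous (fun p : E × E => fderiv ℝ f p.1 p.2) := by
    have := hf.continuous_fderiv (by simp)
    fun_prop
  -- Pathwise bound: the increment is the integral of the derivative along the rotation.
  have hpt : ∀ p : E × E, ‖f (Real.cos θ • p.1 + Real.sin θ • p.2) - f p.1‖ₑ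
      ≤ ∫⁻ s in Set.Ioc 0 θ, ‖fderiv ℝ f (R s p).1 (R s p).2‖ₑ := by
    intro p
    have hder : ∀ s ∈ Set.uIcc 0 θ, HasDerivAt (fun s => f (R s p).1)
        (fderiv ℝ f (R s p).1 (R s p).2) s := by
      intro s _
      have h1 : HasDerivAt (fun s => (R s p).1) (R s p).2 s :=
        ((Real.hasDerivAt_cos s).smul_const p.1).add ((Real.hasDerivAt_sin s).smul_const p.2)
      exact ((hf.differentiable (by simp)).differentiableAt.hasFDerivAt).comp_hasDerivAt s h1
    have hcont : Continuous fun s => fderiv ℝ f (R s p).1 (R s p).2 :=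
      hfd.comp (hRc.comp (by fun_prop : Continuous fun s : ℝ => (p, s)))
    have := intervalIntegral.integral_eq_sub_of_hasDerivAt hder (hcont.intervalIntegrable _ _)
    have h0 : (R 0 p).1 = p.1 := by simp [hR]
    rw [h0] at this
    change ‖f (R θ p).1 - f p.1‖ₑ ≤ _
    rw [← this, intervalIntegral.integral_of_le hθ]
    exact enorm_integral_le_lintegral_enorm _
  calc _ ≤ ∫⁻ p : E × E, (∫⁻ s in Set.Ioc 0 θ, ‖fderiv ℝ f (R s p).1 (R s p).2‖ₑ)
        ∂((stdGaussian E).prod (stdGaussian E)) := lintegral_mono hpt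
    _ = ∫⁻ s in Set.Ioc 0 θ, (∫⁻ p : E × E, ‖fderiv ℝ f (R s p).1 (R s p).2‖ₑ
        ∂((stdGaussian E).prod (stdGaussian E))) := by
      apply lintegral_lintegral_swap
      exact (hfd.comp hRc).measurable.enorm.aemeasurable
    _ = ∫⁻ _ in Set.Ioc 0 θ, (∫⁻ p : E × E, ‖fderiv ℝ f p.1 p.2‖ₑ
        ∂((stdGaussian E).prod (stdGaussian E))) := by
      -- By rotation invariance the inner integral does not depend on `s`.
      congr 1
      ext s
      exact (measurePreserving_rotation_stdGaussian s).lintegral_comp hfd.measurable.enorm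
    _ = _ := by simp [mul_comm]

end GaussianSpace

/-! ### Absolute moments of Gaussian marginals -/

lemma integral_Ioi_mul_exp_neg_mul_sq {b : ℝ} (hb : 0 < b) :
    ∫ x in Set.Ioi (0 : ℝ), x * Real.exp (-b * x ^ 2) = (2 * b)⁻¹ := by
  have h := integral_rpow_mul_exp_neg_mul_rpow (p := 2) (q := 1) two_pos (by norm_num) hb
  have h1 : -((1 : ℝ) + 1) / 2 = -1 := by norm_num
  have h2 : ((1 : ℝ) + 1) / 2 = 1 := by norm_num
  rw [h1, h2, Real.Gamma_one, Real.rpow_neg_one] at h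
  simp only [Real.rpow_one, Real.rpow_two] at h
  rw [h]
  field_simp

lemma integral_abs_gaussianReal (v : NNReal) :
    ∫ x, |x| ∂(gaussianReal 0 v) = Real.sqrt v * Real.sqrt (2 / Real.pi) := by
  rcases eq_or_ne v 0 with rfl | hv
  · simp
  rw [integral_gaussianReal_eq_integral_smul hv]
  have hv' : (0 : ℝ) < v := by positivity
  have h := integral_comp_abs (f := fun x : ℝ => gaussianPDFReal 0 v x * x)
  have h1 : ∀ x : ℝ, gaussianPDFReal 0 v x • |x| = gaussianPDFReal 0 v |x| * |x| := by
    intro x; simp [gaussianPDFReal]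
  simp_rw [h1]
  rw [h]
  have h2 : ∀ x : ℝ, gaussianPDFReal 0 v x * x
      = (Real.sqrt (2 * Real.pi * v))⁻¹ * (x * Real.exp (-(2 * (v : ℝ))⁻¹ * x ^ 2)) := by
    intro x
    simp only [gaussianPDFReal, sub_zero]
    rw [show -(2 * (v : ℝ))⁻¹ * x ^ 2 = -x ^ 2 / (2 * v) by field_simp]
    ring
  simp_rw [h2]
  rw [integral_const_mul, integral_Ioi_mul_exp_neg_mul_sq (by positivity), ← Real.sqrt_mul hv'.le]
  refine (Real.sqrt_eq_iff_mul_self_eq (by positivity) (by positivity)).2 ?_ |>.symm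
  set w := Real.sqrt (2 * Real.pi * v) with hw
  have hw2 : w ^ 2 = 2 * Real.pi * v := Real.sq_sqrt (by positivity)
  have hw0 : 0 < w := by positivity
  field_simp
  rw [hw2]
  ring

section Marginal

variable {E : Type*} [NormedAddCommGroup E] [InnerProductSpace ℝ E] [FiniteDimensional ℝ E]
  [MeasurableSpace E] [BorelSpace E]

lemma map_strongDual_stdGaussian (L : StrongDual ℝ E) :
    (stdGaussian E).map L = gaussianReal 0 (‖L‖₊ ^ 2) := by
  rw [IsGaussian.map_eq_gaussianReal, integral_strongDual_stdGaussian, variance_dual_stdGaussian]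
  congr 1
  ext
  simp

lemma lintegral_enorm_inner_stdGaussian (x : E) :
    ∫⁻ y, ‖inner ℝ x y‖ₑ ∂(stdGaussian E)
      = ENNReal.ofReal (‖x‖ * Real.sqrt (2 / Real.pi)) := by
  have h := map_strongDual_stdGaussian (innerSL ℝ x)
  have h1 : ∫⁻ y, ‖inner ℝ x y‖ₑ ∂(stdGaussian E)
      = ∫⁻ z, ‖z‖ₑ ∂(gaussianReal 0 (‖innerSL ℝ x‖₊ ^ 2)) := by
    rw [← h, lintegral_map (by fun_prop) (by fun_prop)]
    simp
  rw [h1, ← ofReal_integral_norm_eq_lintegral_enorm (f := fun z : ℝ => z)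
    ((memLp_id_gaussianReal 1).integrable (by simp))]
  simp only [Real.norm_eq_abs, integral_abs_gaussianReal]
  simp [innerSL_apply_norm, Real.sqrt_sq]

end Marginal

/-! ### Central limit theorem for the squared length -/

lemma integral_pow_four_gaussianReal : ∫ x, x ^ 4 ∂(gaussianReal 0 1) = 3 := by
  rw [integral_gaussianReal_eq_integral_smul one_ne_zero]
  have h := integral_comp_abs (f := fun x : ℝ => gaussianPDFReal 0 1 x * x ^ 4)
  have h1 : ∀ x : ℝ, gaussianPDFReal 0 1 x • x ^ 4 = gaussianPDFReal 0 1 |x| * |x| ^ 4 := by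
    intro x
    simp [gaussianPDFReal, Even.pow_abs (show Even 4 by decide)]
  simp_rw [h1]
  rw [h]
  have h2 : ∀ x : ℝ, gaussianPDFReal 0 1 x * x ^ 4
      = (Real.sqrt (2 * Real.pi))⁻¹ * (x ^ (4 : ℝ) * Real.exp (-(1 / 2) * x ^ (2 : ℝ))) := by
    intro x
    have h4 : x ^ (4 : ℝ) = x ^ 4 := by exact_mod_cast Real.rpow_natCast x 4
    rw [h4, Real.rpow_two]
    simp only [gaussianPDFReal, sub_zero, NNReal.coe_one, mul_one]
    rw [show -(1 / 2) * x ^ 2 = -x ^ 2 / 2 by ring]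
    ring
  simp_rw [h2]
  rw [integral_const_mul, integral_rpow_mul_exp_neg_mul_rpow two_pos (by norm_num) (by norm_num)]
  have hG : Real.Gamma ((4 + 1) / 2) = 3 / 4 * Real.sqrt Real.pi := by
    rw [show ((4 : ℝ) + 1) / 2 = (1 / 2 + 1) + 1 by norm_num, Real.Gamma_add_one (by norm_num),
      Real.Gamma_add_one (by norm_num), Real.Gamma_one_half_eq]
    ring
  have hp : (1 / 2 : ℝ) ^ (-((4 : ℝ) + 1) / 2) = 4 * Real.sqrt 2 := by
    rw [show -((4 : ℝ) + 1) / 2 = -(2 + 1 / 2) by norm_num, one_div (2 : ℝ),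
      Real.inv_rpow two_pos.le, Real.rpow_neg two_pos.le, inv_inv, Real.rpow_add two_pos,
      ← one_div, ← Real.sqrt_eq_rpow]
    norm_num
  rw [hG, hp, Real.sqrt_mul two_pos.le]
  have : 0 < Real.sqrt 2 := by positivity
  have : 0 < Real.sqrt Real.pi := by have := Real.pi_pos; positivity
  field_simp

lemma integrable_pow_gaussianReal (k : ℕ) :
    Integrable (fun x : ℝ => x ^ k) (gaussianReal 0 1) := by
  have := (memLp_id_gaussianReal' (μ := 0) (v := 1) k (by simp)).integrable_norm_pow'
  refine (integrable_norm_iff (by fun_prop)).1 ?_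
  simpa using this

lemma integral_sq_gaussianReal : ∫ x, x ^ 2 ∂(gaussianReal 0 1) = 1 := by
  have h := variance_fun_id_gaussianReal (μ := 0) (v := 1)
  rw [variance_eq_integral (by fun_prop)] at h
  simpa using h

/-- The standardized squared length of a vector. -/
noncomputable def stdSqNorm (n : ℕ) (x : EuclideanSpace ℝ (Fin n)) : ℝ :=
  (Real.sqrt n)⁻¹ * ((‖x‖ ^ 2 - n) / Real.sqrt 2)

lemma continuous_stdSqNorm (n : ℕ) : Continuous (stdSqNorm n) := by
  unfold stdSqNorm
  fun_prop

/-- The law of the standardized squared length of a standard Gaussian vector. -/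
noncomputable def stdSqNormLaw (n : ℕ) : ProbabilityMeasure ℝ :=
  ⟨(stdGaussian (EuclideanSpace ℝ (Fin n))).map (stdSqNorm n),
    Measure.isProbabilityMeasure_map (continuous_stdSqNorm n).measurable.aemeasurable⟩

/-- The coordinates are independent and `stdSqNorm` is `1/√n` times the sum of the `(x i ^ 2 - 1) /
√2`. -/
lemma charFun_stdSqNormLaw (n : ℕ) (t : ℝ) :
    charFun (stdSqNormLaw n : Measure ℝ) t
      = charFun ((gaussianReal 0 1).map fun x => (x ^ 2 - 1) / Real.sqrt 2)
          ((Real.sqrt n)⁻¹ * t) ^ n := by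
  change charFun ((stdGaussian (EuclideanSpace ℝ (Fin n))).map (stdSqNorm n)) t = _
  rw [← map_pi_eq_stdGaussian, Measure.map_map (continuous_stdSqNorm n).measurable (by fun_prop),
    charFun_apply_real, charFun_apply_real,
    integral_map (((continuous_stdSqNorm n).measurable.comp (by fun_prop)).aemeasurable)
      (by fun_prop),
    integral_map (by fun_prop) (by fun_prop)]
  have h : ∀ x : Fin n → ℝ, Complex.exp (t * ((stdSqNorm n ∘ WithLp.toLp 2) x : ℝ) * Complex.I)
      = ∏ i, Complex.exp (((Real.sqrt n)⁻¹ * t : ℝ) * (((x i) ^ 2 - 1) / Real.sqrt 2 : ℝ)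
        * Complex.I) := by
    intro x
    rw [← Complex.exp_sum, ← Finset.sum_mul, ← Finset.mul_sum]
    congr 2
    norm_cast
    rw [← Finset.sum_div, Finset.sum_sub_distrib]
    simp [stdSqNorm, EuclideanSpace.norm_sq_eq]
    ring
  simp_rw [h]
  rw [integral_fintype_prod_eq_prod (𝕜 := ℂ) (fun _ (y : ℝ) =>
    Complex.exp (((Real.sqrt n)⁻¹ * t : ℝ) * ((y ^ 2 - 1) / Real.sqrt 2 : ℝ) * Complex.I))]
  simp

/-- The standardized squared length of a Gaussian vector is asymptotically normal. -/
lemma tendsto_stdSqNormLaw :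
    Tendsto stdSqNormLaw atTop (𝓝 (⟨gaussianReal 0 1, inferInstance⟩ : ProbabilityMeasure ℝ)) := by
  refine ProbabilityMeasure.tendsto_iff_tendsto_charFun.2 fun t => ?_
  simp_rw [charFun_stdSqNormLaw]
  have h2 := integral_sq_gaussianReal
  have i2 := integrable_pow_gaussianReal 2
  have i4 := integrable_pow_gaussianReal 4
  -- The side goals are mean `0` and second moment `(3 - 2 + 1) / 2 = 1`.
  have := tendsto_charFun_inv_sqrt_mul_pow (P := gaussianReal 0 1)
    (X := fun x => (x ^ 2 - 1) / Real.sqrt 2) (by fun_prop) ?_ ?_ t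
  · simpa [charFun_gaussianReal, neg_div] using this
  · rw [integral_div, integral_sub i2 (by simp), h2]
    simp
  · have : ∀ x : ℝ, ((fun x : ℝ => (x ^ 2 - 1) / Real.sqrt 2) ^ 2) x
        = (x ^ 4 - 2 * x ^ 2 + 1) / 2 := by
      intro x
      simp only [Pi.pow_apply, div_pow, Real.sq_sqrt two_pos.le]
      ring
    simp_rw [this]
    rw [integral_div, integral_add (f := fun x : ℝ => x ^ 4 - 2 * x ^ 2)
        (i4.sub (i2.const_mul 2)) (integrable_const _),
      integral_sub i4 (i2.const_mul 2), integral_const_mul, h2, integral_pow_four_gaussianReal]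
    simp
    norm_num

/-! ### Noise variance as a crossing probability -/

lemma indicator_one_norm_le {α : Type*} (A : Set α) (x : α) :
    ‖A.indicator (fun _ => (1 : ℝ)) x‖ ≤ 1 := by
  by_cases h : x ∈ A <;> simp [h]

/-- The noise variance in terms of the probability that a Gaussian rotation crosses the boundary. -/
lemma noiseVariance_eq {n : ℕ} {t : ℝ} (ht : 0 < t) {A : Set (EuclideanSpace ℝ (Fin n))}
    (hA : MeasurableSet A) {θ : ℝ} (hcos : Real.cos θ = Real.exp (-2 * t))
    (hsin : 0 ≤ Real.sin θ) :
    noiseVariance t A = (gaussianMeasure n).real A - (gaussianMeasure n).real A ^ 2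
      - 1 / 2 * ∫ p, |A.indicator (fun _ => (1 : ℝ)) p.1
          - A.indicator (fun _ => (1 : ℝ)) (Real.cos θ • p.1 + Real.sin θ • p.2)|
        ∂((gaussianMeasure n).prod (gaussianMeasure n)) := by
  unfold noiseVariance ornsteinUhlenbeck gaussianMeasure
  set γ := stdGaussian (EuclideanSpace ℝ (Fin n)) with hγ
  set f := A.indicator (fun _ => (1 : ℝ)) with hf
  set ρ := Real.exp (-t) with hρ
  set σ := Real.sqrt (1 - Real.exp (-2 * t)) with hσ
  have hρ2 : ρ ^ 2 = Real.exp (-2 * t) := by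
    rw [hρ, ← Real.exp_nat_mul]
    congr 1
    push_cast
    ring
  have hlt : Real.exp (-2 * t) < 1 := by
    rw [Real.exp_lt_one_iff]
    linarith
  have hσ0 : 0 < σ := Real.sqrt_pos.2 (by linarith)
  have hρσ : ρ ^ 2 + σ ^ 2 = 1 := by
    rw [hρ2, hσ, Real.sq_sqrt (by linarith)]
    ring
  have hfm : Measurable f := measurable_const.indicator hA
  have hf1 : ∀ x, ‖f x‖ ≤ 1 := indicator_one_norm_le A
  have hff1 : ∀ x y, ‖f x * f y‖ ≤ 1 := fun x y => by
    rw [norm_mul]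
    exact mul_le_one₀ (hf1 x) (norm_nonneg _) (hf1 y)
  have hfint : ∫ x, f x ∂γ = γ.real A := by
    rw [hf, integral_indicator_const _ hA]
    simp
  have hPm : StronglyMeasurable fun x => ∫ y, f (ρ • x + σ • y) ∂γ :=
    StronglyMeasurable.integral_prod_right' (f := fun p : _ × _ => f (ρ • p.1 + σ • p.2))
      (by fun_prop : Measurable _).stronglyMeasurable
  have hP1 : ∀ x, ‖∫ y, f (ρ • x + σ • y) ∂γ‖ ≤ 1 := fun x => by
    simpa using norm_integral_le_of_norm_le_const (μ := γ)
      (.of_forall fun y => hf1 (ρ • x + σ • y))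
  have hmean : ∫ x, ∫ y, f (ρ • x + σ • y) ∂γ ∂γ = γ.real A := by
    have hmp := measurePreserving_comb_stdGaussian (E := EuclideanSpace ℝ (Fin n)) hρσ
    rw [← integral_prod (fun p : _ × _ => f (ρ • p.1 + σ • p.2))
      (.of_bound (by fun_prop : Measurable _).aestronglyMeasurable 1 (.of_forall fun p => hf1 _)),
      ← hfint, hγ, ← hmp.map_eq, integral_map (by fun_prop) hfm.aestronglyMeasurable]
    rw [hmp.map_eq]
  -- The square of the inner integral is an integral over two independent noises, that is, over a
  -- noisy pair.
  have hsq : ∫ x, (∫ y, f (ρ • x + σ • y) ∂γ) ^ 2 ∂γ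
      = ∫ p : _ × _, f p.1 * f (Real.cos θ • p.1 + Real.sin θ • p.2) ∂(γ.prod γ) := by
    rw [← integral_noisy_pair (F := fun p => f p.1 * f p.2) hρσ hσ0 (hcos.trans hρ2.symm) hsin
      (by fun_prop), integral_prod]
    · congr 1
      ext x
      rw [sq, ← integral_prod_mul]
    · exact .of_bound (by fun_prop : Measurable _).aestronglyMeasurable 1
        (.of_forall fun p => hff1 _ _)
  rw [variance_eq_sub (.of_bound hPm.aestronglyMeasurable 1 (.of_forall hP1))]
  simp only [Pi.pow_apply]
  rw [hmean, hsq]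
  have hrot := measurePreserving_comb_stdGaussian (E := EuclideanSpace ℝ (Fin n))
    (Real.cos_sq_add_sin_sq θ)
  have h1 : ∫ p : _ × _, f p.1 ∂(γ.prod γ) = γ.real A := by
    rw [integral_fun_fst, hfint]; simp
  have h2 : ∫ p : _ × _, f (Real.cos θ • p.1 + Real.sin θ • p.2) ∂(γ.prod γ) = γ.real A := by
    have := integral_map (μ := γ.prod γ) hrot.measurable.aemeasurable hfm.aestronglyMeasurable
    rw [hrot.map_eq, hfint] at this
    exact this.symm
  -- Valid because `f` takes only the values `0` and `1`; it turns the correlation into a crossing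
  -- probability.
  have habs : ∀ x y, |f x - f y| = f x + f y - 2 * (f x * f y) := by
    intro x y
    by_cases hx : x ∈ A <;> by_cases hy : y ∈ A <;> norm_num [hf, hx, hy]
  simp_rw [habs]
  have i1 : Integrable (fun p : _ × _ => f p.1) (γ.prod γ) :=
    .of_bound (by fun_prop : Measurable _).aestronglyMeasurable 1 (.of_forall fun p => hf1 _)
  have i2 : Integrable (fun p : _ × _ => f (Real.cos θ • p.1 + Real.sin θ • p.2)) (γ.prod γ) :=
    .of_bound (by fun_prop : Measurable _).aestronglyMeasurable 1 (.of_forall fun p => hf1 _)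
  have i3 : Integrable (fun p : _ × _ => f p.1 * f (Real.cos θ • p.1 + Real.sin θ • p.2))
      (γ.prod γ) :=
    .of_bound (by fun_prop : Measurable _).aestronglyMeasurable 1 (.of_forall fun p => hff1 _ _)
  have i12 : Integrable (fun p : _ × _ => f p.1 + f (Real.cos θ • p.1 + Real.sin θ • p.2))
      (γ.prod γ) := i1.add i2
  rw [integral_sub i12 (i3.const_mul 2), integral_add i1 i2, integral_const_mul, h1, h2]
  ring

/-! ### Gaussian density bounds and limits of probabilities -/

lemma gaussianPDFReal_zero_one_le (x : ℝ) :
    gaussianPDFReal 0 1 x ≤ (Real.sqrt (2 * Real.pi))⁻¹ := by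
  simp only [gaussianPDFReal, sub_zero, NNReal.coe_one, mul_one]
  refine mul_le_of_le_one_right (by positivity) (Real.exp_le_one_iff.2 ?_)
  have := sq_nonneg x
  linarith

lemma inv_sqrt_two_pi_le_one : (Real.sqrt (2 * Real.pi))⁻¹ ≤ 1 := by
  refine inv_le_one_of_one_le₀ (Real.one_le_sqrt.2 ?_)
  linarith [Real.pi_gt_three]

lemma gaussianReal_real_Icc_le {δ : ℝ} (hδ : 0 ≤ δ) :
    (gaussianReal 0 1).real (Set.Icc 0 δ) ≤ δ := by
  have h : gaussianReal 0 1 (Set.Icc 0 δ) ≤ ENNReal.ofReal δ := by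
    rw [gaussianReal_apply 0 one_ne_zero]
    calc _ ≤ ∫⁻ _ in Set.Icc 0 δ, 1 := by
          refine lintegral_mono fun x => ?_
          rw [gaussianPDF, ← ENNReal.ofReal_one]
          exact ENNReal.ofReal_le_ofReal
            ((gaussianPDFReal_zero_one_le x).trans inv_sqrt_two_pi_le_one)
      _ = _ := by simp
  exact ENNReal.toReal_le_of_le_ofReal hδ h

lemma gaussianReal_real_Iic_zero : (gaussianReal 0 1).real (Set.Iic 0) = 1 / 2 := by
  have := nullSingletonClass_gaussianReal (μ := 0) (v := 1) one_ne_zero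
  have h1 : (gaussianReal 0 1).real (Set.Ioi 0) = (gaussianReal 0 1).real (Set.Iic 0) := by
    conv_rhs => rw [← neg_zero, ← gaussianReal_map_neg, neg_zero]
    rw [map_measureReal_apply (by fun_prop) measurableSet_Iic]
    simp only [Set.preimage, Set.mem_Iic, Left.neg_nonpos_iff]
    exact (measureReal_congr Ioi_ae_eq_Ici)
  have h2 := probReal_compl_eq_one_sub (μ := gaussianReal 0 1) (measurableSet_Iic (a := (0 : ℝ)))
  rw [Set.compl_Iic, h1] at h2
  linarith

/-- Portmanteau: the Gaussian limit has no atoms, so a countable frontier is null. -/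
lemma tendsto_stdSqNormLaw_real {s : Set ℝ} (hs : (frontier s).Countable) :
    Tendsto (fun n => (stdSqNormLaw n : Measure ℝ).real s) atTop
      (𝓝 ((gaussianReal 0 1).real s)) := by
  have := nullSingletonClass_gaussianReal (μ := 0) (v := 1) one_ne_zero
  have h := ProbabilityMeasure.tendsto_measure_of_null_frontier_of_tendsto' tendsto_stdSqNormLaw
    (E := s) (hs.measure_zero (gaussianReal 0 1))
  exact (ENNReal.tendsto_toReal (measure_ne_top _ _)).comp h

/-! ### The smooth ramp and its mean slope -/

/-- A smooth monotone ramp from `0` to `1` on the interval `[0, δ]`. -/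
noncomputable def smoothRamp (δ z : ℝ) : ℝ := Real.smoothTransition (z / δ)

section SmoothRamp

variable {δ : ℝ}

lemma contDiff_smoothRamp : ContDiff ℝ 1 (smoothRamp δ) :=
  (Real.smoothTransition.contDiff (n := 1)).comp (contDiff_id.div_const δ)

lemma continuous_deriv_smoothRamp : Continuous (deriv (smoothRamp δ)) :=
  contDiff_smoothRamp.continuous_deriv le_rfl

lemma smoothRamp_of_nonpos (hδ : 0 < δ) {z : ℝ} (hz : z ≤ 0) : smoothRamp δ z = 0 :=
  Real.smoothTransition.zero_of_nonpos (div_nonpos_of_nonpos_of_nonneg hz hδ.le)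

lemma smoothRamp_of_le (hδ : 0 < δ) {z : ℝ} (hz : δ ≤ z) : smoothRamp δ z = 1 :=
  Real.smoothTransition.one_of_one_le ((one_le_div hδ).2 hz)

lemma smoothRamp_nonneg (z : ℝ) : 0 ≤ smoothRamp δ z := Real.smoothTransition.nonneg _

lemma smoothRamp_le_one (z : ℝ) : smoothRamp δ z ≤ 1 := Real.smoothTransition.le_one _

lemma deriv_smoothRamp_nonneg (hδ : 0 < δ) (z : ℝ) : 0 ≤ deriv (smoothRamp δ) z := by
  have : Monotone (smoothRamp δ) := fun a b hab =>
    Real.smoothTransition.monotone (div_le_div_of_nonneg_right hab hδ.le)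
  exact this.deriv_nonneg

lemma deriv_smoothRamp_eq_zero (hδ : 0 < δ) {z : ℝ} (hz : z ∉ Set.Icc 0 δ) :
    deriv (smoothRamp δ) z = 0 := by
  have h : z < 0 ∨ δ < z := by
    by_contra! h
    exact hz h
  rcases h with h | h
  · have : smoothRamp δ =ᶠ[𝓝 z] fun _ => 0 :=
      (eventually_lt_nhds h).mono fun w hw => smoothRamp_of_nonpos hδ hw.le
    rw [this.deriv_eq, deriv_const]
  · have : smoothRamp δ =ᶠ[𝓝 z] fun _ => 1 :=
      (eventually_gt_nhds h).mono fun w hw => smoothRamp_of_le hδ hw.le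
    rw [this.deriv_eq, deriv_const]

lemma hasCompactSupport_deriv_smoothRamp (hδ : 0 < δ) :
    HasCompactSupport (deriv (smoothRamp δ)) :=
  .intro isCompact_Icc fun _ hz => deriv_smoothRamp_eq_zero hδ hz

lemma integrable_deriv_smoothRamp (hδ : 0 < δ) : Integrable (deriv (smoothRamp δ)) :=
  continuous_deriv_smoothRamp.integrable_of_hasCompactSupport
    (hasCompactSupport_deriv_smoothRamp hδ)

lemma integral_deriv_smoothRamp (hδ : 0 < δ) : ∫ z, deriv (smoothRamp δ) z = 1 := by
  rw [integral_of_hasDerivAt_of_tendsto (f := smoothRamp δ) (m := 0) (n := 1)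
    (fun z => (contDiff_smoothRamp.differentiable (by simp)).differentiableAt.hasDerivAt)
    (integrable_deriv_smoothRamp hδ)]
  · simp
  · exact tendsto_const_nhds.congr' ((eventually_le_atBot 0).mono fun z hz =>
      (smoothRamp_of_nonpos hδ hz).symm)
  · exact tendsto_const_nhds.congr' ((eventually_ge_atTop δ).mono fun z hz =>
      (smoothRamp_of_le hδ hz).symm)

/-- The slope has total mass `1` and the density is at most its peak, so the bound is free of `δ`.
-/
lemma integral_deriv_smoothRamp_gaussianReal_le (hδ : 0 < δ) :
    ∫ z, deriv (smoothRamp δ) z ∂(gaussianReal 0 1) ≤ (Real.sqrt (2 * Real.pi))⁻¹ := by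
  rw [integral_gaussianReal_eq_integral_smul one_ne_zero]
  calc _ ≤ ∫ z, (Real.sqrt (2 * Real.pi))⁻¹ * deriv (smoothRamp δ) z := by
        refine integral_mono_of_nonneg (.of_forall fun z => ?_)
          ((integrable_deriv_smoothRamp hδ).const_mul _) (.of_forall fun z => ?_)
        · exact mul_nonneg (gaussianPDFReal_nonneg _ _ _) (deriv_smoothRamp_nonneg hδ z)
        · exact mul_le_mul_of_nonneg_right (gaussianPDFReal_zero_one_le z)
            (deriv_smoothRamp_nonneg hδ z)
    _ = _ := by rw [integral_const_mul, integral_deriv_smoothRamp hδ, mul_one]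

lemma exists_deriv_smoothRamp_le (hδ : 0 < δ) : ∃ C, ∀ z, ‖deriv (smoothRamp δ) z‖ ≤ C :=
  (hasCompactSupport_deriv_smoothRamp hδ).exists_bound_of_continuous continuous_deriv_smoothRamp

/-- Smoothness of the ramp matters here: weak convergence tests against a bounded continuous slope.
-/
lemma tendsto_integral_deriv_smoothRamp (hδ : 0 < δ) :
    Tendsto (fun n => ∫ z, deriv (smoothRamp δ) z ∂(stdSqNormLaw n : Measure ℝ)) atTop
      (𝓝 (∫ z, deriv (smoothRamp δ) z ∂(gaussianReal 0 1))) := by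
  obtain ⟨C, hC⟩ := exists_deriv_smoothRamp_le hδ
  exact ProbabilityMeasure.tendsto_iff_forall_integral_tendsto.1 tendsto_stdSqNormLaw
    (BoundedContinuousFunction.ofNormedAddCommGroup _ continuous_deriv_smoothRamp C hC)

end SmoothRamp

/-! ### Gradient of the ramped squared length -/

lemma hasFDerivAt_stdSqNorm {n : ℕ} (x : EuclideanSpace ℝ (Fin n)) :
    HasFDerivAt (stdSqNorm n)
      (((Real.sqrt n)⁻¹ * (2 / Real.sqrt 2)) • innerSL ℝ x) x := by
  have h := (hasStrictFDerivAt_norm_sq x).hasFDerivAt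
  have h2 := ((h.sub_const (n : ℝ)).mul_const (Real.sqrt 2)⁻¹).const_mul (Real.sqrt n)⁻¹
  refine h2.congr_fderiv ?_
  ext y
  rw [div_eq_mul_inv (2 : ℝ)]
  simp
  ring

lemma contDiff_stdSqNorm (n : ℕ) : ContDiff ℝ 1 (stdSqNorm n) := by
  unfold stdSqNorm
  have := contDiff_norm_sq ℝ (E := EuclideanSpace ℝ (Fin n)) (n := 1)
  fun_prop

/-- Since `|x|²/n = 1 + √2 Z/√n`, the norm is under control wherever the ramp has nonzero slope. -/
lemma norm_le_of_stdSqNorm_le {n : ℕ} (hn : 0 < n) {x : EuclideanSpace ℝ (Fin n)} {δ : ℝ}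
    (hx : stdSqNorm n x ≤ δ) :
    (Real.sqrt n)⁻¹ * ‖x‖ ≤ Real.sqrt (1 + Real.sqrt 2 * δ * (Real.sqrt n)⁻¹) := by
  have hn' : (0 : ℝ) < Real.sqrt n := Real.sqrt_pos.2 (by exact_mod_cast hn)
  have hn2 : Real.sqrt n ^ 2 = n := Real.sq_sqrt (by positivity)
  apply Real.le_sqrt_of_sq_le
  have h : ‖x‖ ^ 2 = Real.sqrt n ^ 2 + Real.sqrt 2 * stdSqNorm n x * Real.sqrt n := by
    rw [stdSqNorm, hn2]
    field_simp
    ring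
  rw [mul_pow, h]
  have : ((Real.sqrt n)⁻¹) ^ 2 * (Real.sqrt n ^ 2 + Real.sqrt 2 * stdSqNorm n x * Real.sqrt n)
      = 1 + Real.sqrt 2 * stdSqNorm n x * (Real.sqrt n)⁻¹ := by
    field_simp
  rw [this]
  gcongr

/-- The constant multiplying the mean slope of the ramp in the crossing bound. -/
noncomputable def slopeConst (δ : ℝ) (n : ℕ) : ℝ :=
  2 / Real.sqrt 2 * Real.sqrt (2 / Real.pi) *
    Real.sqrt (1 + Real.sqrt 2 * δ * (Real.sqrt n)⁻¹)

lemma slopeConst_nonneg (δ : ℝ) (n : ℕ) : 0 ≤ slopeConst δ n := by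
  unfold slopeConst
  positivity

/-- The gradient at `x` is a nonnegative multiple of `x`; averaging `|⟨x, y⟩|` over `y` gives `|x|
√(2/π)`. -/
lemma lintegral_fderiv_smoothRamp_le {n : ℕ} (hn : 0 < n) {δ : ℝ} (hδ : 0 < δ) :
    ∫⁻ p : EuclideanSpace ℝ (Fin n) × EuclideanSpace ℝ (Fin n),
        ‖fderiv ℝ (smoothRamp δ ∘ stdSqNorm n) p.1 p.2‖ₑ
        ∂((gaussianMeasure n).prod (gaussianMeasure n))
      ≤ ENNReal.ofReal (slopeConst δ n *
          ∫ z, deriv (smoothRamp δ) z ∂(stdSqNormLaw n : Measure ℝ)) := by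
  unfold gaussianMeasure
  set γ := stdGaussian (EuclideanSpace ℝ (Fin n)) with hγ
  have hcd : ContDiff ℝ 1 (smoothRamp δ ∘ stdSqNorm n) :=
    contDiff_smoothRamp.comp (contDiff_stdSqNorm n)
  have hfd : Continuous (fun p : EuclideanSpace ℝ (Fin n) × EuclideanSpace ℝ (Fin n) =>
      fderiv ℝ (smoothRamp δ ∘ stdSqNorm n) p.1 p.2) := by
    have := hcd.continuous_fderiv (by simp)
    fun_prop
  have hval : ∀ x y : EuclideanSpace ℝ (Fin n), fderiv ℝ (smoothRamp δ ∘ stdSqNorm n) x y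
      = (deriv (smoothRamp δ) (stdSqNorm n x) * ((Real.sqrt n)⁻¹ * (2 / Real.sqrt 2)))
        * inner ℝ x y := by
    intro x y
    have h1 : HasDerivAt (smoothRamp δ) (deriv (smoothRamp δ) (stdSqNorm n x)) (stdSqNorm n x) :=
      (contDiff_smoothRamp.differentiable (by simp)).differentiableAt.hasDerivAt
    rw [(h1.comp_hasFDerivAt x (hasFDerivAt_stdSqNorm x)).fderiv]
    simp
    ring
  have hint : ∫ z, deriv (smoothRamp δ) z ∂(stdSqNormLaw n : Measure ℝ)
      = ∫ x, deriv (smoothRamp δ) (stdSqNorm n x) ∂γ :=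
    integral_map (continuous_stdSqNorm n).measurable.aemeasurable
      continuous_deriv_smoothRamp.aestronglyMeasurable
  have hcont : Continuous fun x => deriv (smoothRamp δ) (stdSqNorm n x) :=
    continuous_deriv_smoothRamp.comp (continuous_stdSqNorm n)
  have hintegrable : Integrable (fun x => deriv (smoothRamp δ) (stdSqNorm n x)) γ := by
    obtain ⟨C, hC⟩ := exists_deriv_smoothRamp_le hδ
    exact .of_bound hcont.aestronglyMeasurable C (.of_forall fun x => hC _)
  rw [lintegral_prod _ hfd.measurable.enorm.aemeasurable, hint, ← integral_const_mul,
    ofReal_integral_eq_lintegral_ofReal (hintegrable.const_mul _)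
      (.of_forall fun x => mul_nonneg (slopeConst_nonneg δ n) (deriv_smoothRamp_nonneg hδ _))]
  refine lintegral_mono fun x => ?_
  simp_rw [hval, enorm_mul (_ * _) (inner ℝ _ _)]
  rw [lintegral_const_mul _ (by fun_prop), lintegral_enorm_inner_stdGaussian,
    Real.enorm_eq_ofReal (mul_nonneg (deriv_smoothRamp_nonneg hδ _) (by positivity)),
    ← ENNReal.ofReal_mul (mul_nonneg (deriv_smoothRamp_nonneg hδ _) (by positivity))]
  refine ENNReal.ofReal_le_ofReal ?_
  by_cases hz : stdSqNorm n x ∈ Set.Icc 0 δ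
  · have h := norm_le_of_stdSqNorm_le hn hz.2
    have hd := deriv_smoothRamp_nonneg hδ (stdSqNorm n x)
    calc _ = deriv (smoothRamp δ) (stdSqNorm n x) * (2 / Real.sqrt 2 * Real.sqrt (2 / Real.pi))
          * ((Real.sqrt n)⁻¹ * ‖x‖) := by ring
      _ ≤ deriv (smoothRamp δ) (stdSqNorm n x) * (2 / Real.sqrt 2 * Real.sqrt (2 / Real.pi))
          * Real.sqrt (1 + Real.sqrt 2 * δ * (Real.sqrt n)⁻¹) := by gcongr
      _ = _ := by rw [slopeConst]; ring
  · simp [deriv_smoothRamp_eq_zero hδ hz]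

/-! ### Crossing probability of the ball -/

lemma mem_sqrtBall_iff {n : ℕ} (hn : 0 < n) (x : EuclideanSpace ℝ (Fin n)) :
    x ∈ sqrtBall n ↔ stdSqNorm n x ≤ 0 := by
  have hn' : (0 : ℝ) < n := by exact_mod_cast hn
  rw [sqrtBall, mem_closedBall_zero_iff, Real.le_sqrt (norm_nonneg _) hn'.le, stdSqNorm]
  refine ⟨fun h => mul_nonpos_of_nonneg_of_nonpos (by positivity)
    (div_nonpos_of_nonpos_of_nonneg (sub_nonpos.2 h) (by positivity)), fun h => ?_⟩
  by_contra hc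
  exact (mul_pos (by positivity) (div_pos (sub_pos.2 (not_le.1 hc)) (by positivity))).not_ge h

lemma measurableSet_sqrtBall (n : ℕ) : MeasurableSet (sqrtBall n) :=
  Metric.isClosed_closedBall.measurableSet

lemma gaussianMeasure_real_preimage {n : ℕ} {s : Set ℝ} (hs : MeasurableSet s) :
    (gaussianMeasure n).real (stdSqNorm n ⁻¹' s) = (stdSqNormLaw n : Measure ℝ).real s :=
  (map_measureReal_apply (continuous_stdSqNorm n).measurable hs).symm

lemma gaussianMeasure_real_sqrtBall {n : ℕ} (hn : 0 < n) :
    (gaussianMeasure n).real (sqrtBall n) = (stdSqNormLaw n : Measure ℝ).real (Set.Iic 0) := by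
  rw [← gaussianMeasure_real_preimage measurableSet_Iic]
  congr 1
  ext x
  exact mem_sqrtBall_iff hn x

/-- The ramp approximates the indicator of the complement, with error confined to a thin shell. -/
lemma abs_indicator_add_smoothRamp_sub_one_le {n : ℕ} (hn : 0 < n) {δ : ℝ} (hδ : 0 < δ)
    (x : EuclideanSpace ℝ (Fin n)) :
    |(sqrtBall n).indicator (fun _ => (1 : ℝ)) x + smoothRamp δ (stdSqNorm n x) - 1|
      ≤ (stdSqNorm n ⁻¹' Set.Icc 0 δ).indicator (fun _ => (1 : ℝ)) x := by
  by_cases h0 : stdSqNorm n x ≤ 0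
  · rw [Set.indicator_of_mem ((mem_sqrtBall_iff hn x).2 h0), smoothRamp_of_nonpos hδ h0]
    simpa using Set.indicator_nonneg (fun _ _ => zero_le_one) x
  · rw [Set.indicator_of_notMem fun h => h0 ((mem_sqrtBall_iff hn x).1 h)]
    by_cases h1 : stdSqNorm n x ≤ δ
    · rw [Set.indicator_of_mem (show x ∈ stdSqNorm n ⁻¹' Set.Icc 0 δ from ⟨(not_le.1 h0).le, h1⟩),
        abs_le]
      have := smoothRamp_nonneg (δ := δ) (stdSqNorm n x)
      have := smoothRamp_le_one (δ := δ) (stdSqNorm n x)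
      constructor <;> linarith
    · rw [smoothRamp_of_le hδ (not_le.1 h1).le]
      simpa using Set.indicator_nonneg (fun _ _ => zero_le_one) x

/-- Replacing the indicator by one minus the ramp costs the shell mass at each endpoint, both being
standard Gaussian; the rotation bound handles the ramp. -/
lemma integral_crossing_sqrtBall_le {n : ℕ} (hn : 0 < n) {δ θ : ℝ} (hδ : 0 < δ) (hθ : 0 ≤ θ) :
    ∫ p, |(sqrtBall n).indicator (fun _ => (1 : ℝ)) p.1
        - (sqrtBall n).indicator (fun _ => (1 : ℝ)) (Real.cos θ • p.1 + Real.sin θ • p.2)|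
        ∂((gaussianMeasure n).prod (gaussianMeasure n))
      ≤ θ * (slopeConst δ n * ∫ z, deriv (smoothRamp δ) z ∂(stdSqNormLaw n : Measure ℝ))
        + 2 * (stdSqNormLaw n : Measure ℝ).real (Set.Icc 0 δ) := by
  have hsl := lintegral_fderiv_smoothRamp_le hn hδ
  have hmp := measurePreserving_comb_stdGaussian (E := EuclideanSpace ℝ (Fin n))
    (Real.cos_sq_add_sin_sq θ)
  have hκ := gaussianMeasure_real_preimage (n := n) (measurableSet_Icc (a := 0) (b := δ))
  unfold gaussianMeasure at *
  set γ := stdGaussian (EuclideanSpace ℝ (Fin n)) with hγ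
  set f := smoothRamp δ ∘ stdSqNorm n with hf
  set b := (sqrtBall n).indicator (fun _ => (1 : ℝ)) with hb
  set k := (stdSqNorm n ⁻¹' Set.Icc 0 δ).indicator (fun _ => (1 : ℝ)) with hk
  set T : EuclideanSpace ℝ (Fin n) × EuclideanSpace ℝ (Fin n) → EuclideanSpace ℝ (Fin n) :=
    fun p => Real.cos θ • p.1 + Real.sin θ • p.2 with hT
  have hcd : ContDiff ℝ 1 f := contDiff_smoothRamp.comp (contDiff_stdSqNorm n)
  have hcf : Continuous f := hcd.continuous
  have hTc : Continuous T := by fun_prop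
  have hA : MeasurableSet (stdSqNorm n ⁻¹' Set.Icc 0 δ) :=
    (continuous_stdSqNorm n).measurable measurableSet_Icc
  have hkm : Measurable k := measurable_const.indicator hA
  have hkint : ∫ x, k x ∂γ = (stdSqNormLaw n : Measure ℝ).real (Set.Icc 0 δ) := by
    rw [hk, integral_indicator_const _ hA, ← hκ]
    simp
  have i1 : Integrable (fun p : _ × _ => k p.1) (γ.prod γ) :=
    .of_bound (by fun_prop : Measurable _).aestronglyMeasurable 1
      (.of_forall fun p => indicator_one_norm_le _ _)
  have i2 : Integrable (fun p : _ × _ => k (T p)) (γ.prod γ) :=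
    .of_bound (by fun_prop : Measurable _).aestronglyMeasurable 1
      (.of_forall fun p => indicator_one_norm_le _ _)
  have i3 : Integrable (fun p : _ × _ => |f (T p) - f p.1|) (γ.prod γ) := by
    refine .of_bound (by fun_prop : Continuous _).aestronglyMeasurable 1 (.of_forall fun p => ?_)
    rw [Real.norm_eq_abs, abs_abs, abs_le]
    have h1 := smoothRamp_nonneg (δ := δ) (stdSqNorm n (T p))
    have h2 := smoothRamp_le_one (δ := δ) (stdSqNorm n (T p))
    have h3 := smoothRamp_nonneg (δ := δ) (stdSqNorm n p.1)
    have h4 := smoothRamp_le_one (δ := δ) (stdSqNorm n p.1)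
    simp only [hf, Function.comp_apply]
    constructor <;> linarith
  have hk1 : ∫ p : _ × _, k p.1 ∂(γ.prod γ) = (stdSqNormLaw n : Measure ℝ).real (Set.Icc 0 δ) := by
    rw [integral_fun_fst, hkint]; simp
  have hk2 : ∫ p : _ × _, k (T p) ∂(γ.prod γ)
      = (stdSqNormLaw n : Measure ℝ).real (Set.Icc 0 δ) := by
    have := integral_map (μ := γ.prod γ) hmp.measurable.aemeasurable hkm.aestronglyMeasurable
    rw [hmp.map_eq, hkint] at this
    exact this.symm
  have hpath : ∫ p : _ × _, |f (T p) - f p.1| ∂(γ.prod γ)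
      ≤ θ * (slopeConst δ n * ∫ z, deriv (smoothRamp δ) z ∂(stdSqNormLaw n : Measure ℝ)) := by
    have hnn : 0 ≤ slopeConst δ n * ∫ z, deriv (smoothRamp δ) z ∂(stdSqNormLaw n : Measure ℝ) :=
      mul_nonneg (slopeConst_nonneg δ n) (integral_nonneg (deriv_smoothRamp_nonneg hδ))
    have h1 := (lintegral_enorm_sub_rotation_le hcd hθ).trans (mul_le_mul_right hsl _)
    rw [← ENNReal.ofReal_mul hθ] at h1
    have h2 := integral_norm_eq_lintegral_enorm (μ := γ.prod γ) (f := fun p => f (T p) - f p.1)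
      (by fun_prop : Continuous _).aestronglyMeasurable
    simp only [Real.norm_eq_abs] at h2
    rw [h2]
    exact ENNReal.toReal_le_of_le_ofReal (mul_nonneg hθ hnn) h1
  calc _ ≤ ∫ p : _ × _, (|f (T p) - f p.1| + (k p.1 + k (T p))) ∂(γ.prod γ) := by
        refine integral_mono_of_nonneg (.of_forall fun p => abs_nonneg _) (i3.add (i1.add i2))
          (.of_forall fun p => ?_)
        have h1 := abs_indicator_add_smoothRamp_sub_one_le hn hδ p.1
        have h2 := abs_indicator_add_smoothRamp_sub_one_le hn hδ (T p)
        have h3 := abs_add_three (f (T p) - f p.1) (b p.1 + f p.1 - 1) (-(b (T p) + f (T p) - 1))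
        rw [abs_neg] at h3
        calc |b p.1 - b (T p)| = |f (T p) - f p.1 + (b p.1 + f p.1 - 1)
              + -(b (T p) + f (T p) - 1)| := by congr 1; ring
          _ ≤ _ := by
            simp only [hf, Function.comp_apply] at h3 ⊢
            linarith
    _ = ∫ p : _ × _, |f (T p) - f p.1| ∂(γ.prod γ)
        + 2 * (stdSqNormLaw n : Measure ℝ).real (Set.Icc 0 δ) := by
      have i12 : Integrable (fun p : _ × _ => k p.1 + k (T p)) (γ.prod γ) := i1.add i2
      rw [integral_add i3 i12, integral_add i1 i2, hk1, hk2]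
      ring
    _ ≤ _ := by gcongr

/-! ### Uniform error bound and conclusion -/

/-- A bound, uniform in `t`, on how far the noise variance of the ball may fall below its
asymptotic lower bound. -/
noncomputable def deficitBound (δ : ℝ) (n : ℕ) : ℝ :=
  ((stdSqNormLaw n : Measure ℝ).real (Set.Iic 0) - 1 / 2) ^ 2
    + Real.pi / 2 * max 0 (1 / 2 * (slopeConst δ n *
        ∫ z, deriv (smoothRamp δ) z ∂(stdSqNormLaw n : Measure ℝ))
          - (Real.sqrt 2 * Real.pi)⁻¹)
    + (stdSqNormLaw n : Measure ℝ).real (Set.Icc 0 δ)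

/-- Uses `β - β² = 1/4 - (β - 1/2)²` for the ball mass `β`. The factor `θ ≤ π/2` multiplies a
positive part, which removes the dependence on `t`. -/
lemma sub_noiseVariance_sqrtBall_le {n : ℕ} (hn : 0 < n) {δ t : ℝ} (hδ : 0 < δ) (ht : 0 < t) :
    1 / 4 - Real.arccos (Real.exp (-2 * t)) / (Real.sqrt 2 * Real.pi)
      - noiseVariance t (sqrtBall n) ≤ deficitBound δ n := by
  have he0 := Real.exp_pos (-2 * t)
  have he1 : Real.exp (-2 * t) ≤ 1 := Real.exp_le_one_iff.2 (by linarith)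
  set θ := Real.arccos (Real.exp (-2 * t)) with hθ
  have hcos : Real.cos θ = Real.exp (-2 * t) := Real.cos_arccos (by linarith) he1
  have hθ0 : 0 ≤ θ := Real.arccos_nonneg _
  have hθ1 : θ ≤ Real.pi / 2 := Real.arccos_le_pi_div_two.2 he0.le
  have hsin : 0 ≤ Real.sin θ :=
    Real.sin_nonneg_of_nonneg_of_le_pi hθ0 (by linarith [Real.pi_pos])
  have hD := integral_crossing_sqrtBall_le hn hδ hθ0
  rw [noiseVariance_eq ht (measurableSet_sqrtBall n) hcos hsin, gaussianMeasure_real_sqrtBall hn]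
  unfold deficitBound
  set a := slopeConst δ n * ∫ z, deriv (smoothRamp δ) z ∂(stdSqNormLaw n : Measure ℝ)
  have hm : θ * (1 / 2 * a - (Real.sqrt 2 * Real.pi)⁻¹)
      ≤ Real.pi / 2 * max 0 (1 / 2 * a - (Real.sqrt 2 * Real.pi)⁻¹) :=
    (mul_le_mul_of_nonneg_left (le_max_right 0 _) hθ0).trans
      (mul_le_mul_of_nonneg_right hθ1 (le_max_left _ _))
  rw [div_eq_mul_inv θ]
  linarith

lemma tendsto_slopeConst (δ : ℝ) :
    Tendsto (slopeConst δ) atTop (𝓝 (2 / Real.sqrt 2 * Real.sqrt (2 / Real.pi))) := by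
  have h : Tendsto (fun n : ℕ => (Real.sqrt n)⁻¹) atTop (𝓝 0) :=
    tendsto_inv_atTop_zero.comp (Real.tendsto_sqrt_atTop.comp tendsto_natCast_atTop_atTop)
  have h2 := (((h.const_mul (Real.sqrt 2 * δ)).const_add 1).sqrt).const_mul
    (2 / Real.sqrt 2 * Real.sqrt (2 / Real.pi))
  simp only [mul_zero, add_zero, Real.sqrt_one, mul_one] at h2
  exact h2

lemma half_slope_mul_density :
    1 / 2 * (2 / Real.sqrt 2 * Real.sqrt (2 / Real.pi) * (Real.sqrt (2 * Real.pi))⁻¹)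
      = (Real.sqrt 2 * Real.pi)⁻¹ := by
  have h2 : 0 < Real.sqrt 2 := by positivity
  have hp : 0 < Real.sqrt Real.pi := Real.sqrt_pos.2 Real.pi_pos
  have hpp : Real.sqrt Real.pi ^ 2 = Real.pi := Real.sq_sqrt Real.pi_pos.le
  rw [Real.sqrt_div two_pos.le, Real.sqrt_mul two_pos.le, ← hpp, Real.sqrt_sq hp.le]
  field_simp

/-- By `half_slope_mul_density` the limiting slope term is at most the target constant, so its
positive part vanishes and only the shell mass survives. -/
lemma tendsto_deficitBound {δ : ℝ} (hδ : 0 < δ) :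
    Tendsto (deficitBound δ) atTop (𝓝 ((gaussianReal 0 1).real (Set.Icc 0 δ))) := by
  have hβ := tendsto_stdSqNormLaw_real (s := Set.Iic 0) (by simp)
  rw [gaussianReal_real_Iic_zero] at hβ
  have hκ := tendsto_stdSqNormLaw_real (s := Set.Icc 0 δ) (by
    rw [frontier_Icc hδ.le]; exact (Set.toFinite _).countable)
  have ha := ((tendsto_slopeConst δ).mul (tendsto_integral_deriv_smoothRamp hδ)).const_mul (1 / 2)
  have hm := ((tendsto_const_nhds (x := (0 : ℝ))).max
    (ha.sub_const (Real.sqrt 2 * Real.pi)⁻¹)).const_mul (Real.pi / 2)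
  have h := (((hβ.sub_const (1 / 2)).pow 2).add hm).add hκ
  have hle : 1 / 2 * (2 / Real.sqrt 2 * Real.sqrt (2 / Real.pi) *
      ∫ z, deriv (smoothRamp δ) z ∂(gaussianReal 0 1)) - (Real.sqrt 2 * Real.pi)⁻¹ ≤ 0 := by
    rw [← half_slope_mul_density, sub_nonpos]
    have := integral_deriv_smoothRamp_gaussianReal_le hδ
    gcongr
  rw [max_eq_left hle] at h
  have hz : (1 / 2 - 1 / 2 : ℝ) ^ 2 + Real.pi / 2 * 0 + (gaussianReal 0 1).real (Set.Icc 0 δ)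
      = (gaussianReal 0 1).real (Set.Icc 0 δ) := by ring
  rw [hz] at h
  exact h

theorem mainTheorem9 :
    (∃ ε : ℕ → ℝ, Tendsto ε atTop (𝓝 0) ∧
      ∀ (n : ℕ) (t : ℝ), 0 < t →
        noiseVariance t (sqrtBall n) ≥
          1 / 4 - Real.arccos (Real.exp (-2 * t)) / (Real.sqrt 2 * Real.pi) - ε n) ∧
    GaussianNoiseStable (d := fun n => n) (fun n => sqrtBall n) := by
  have hmain : ∃ ε : ℕ → ℝ, Tendsto ε atTop (𝓝 0) ∧
      ∀ (n : ℕ) (t : ℝ), 0 < t →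
        noiseVariance t (sqrtBall n) ≥
          1 / 4 - Real.arccos (Real.exp (-2 * t)) / (Real.sqrt 2 * Real.pi) - ε n := by
    -- Taking `ε n` as the supremum over `t` of the positive deficit keeps `δ` out of its
    -- definition; each tolerance `e` is then met with `δ = e / 2`.
    set D : ℕ → Set.Ioi (0 : ℝ) → ℝ := fun n t => max 0
      (1 / 4 - Real.arccos (Real.exp (-2 * t)) / (Real.sqrt 2 * Real.pi)
        - noiseVariance t.1 (sqrtBall n)) with hD
    have hbdd : ∀ n, BddAbove (Set.range (D n)) := by
      rintro n
      refine ⟨1 / 4, ?_⟩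
      rintro _ ⟨t, rfl⟩
      refine max_le (by norm_num) ?_
      have h1 : 0 ≤ Real.arccos (Real.exp (-2 * t)) / (Real.sqrt 2 * Real.pi) :=
        div_nonneg (Real.arccos_nonneg _) (by have := Real.pi_pos; positivity)
      have h2 : 0 ≤ noiseVariance t.1 (sqrtBall n) := variance_nonneg _ _
      linarith
    refine ⟨fun n => ⨆ t, D n t, ?_, fun n t ht => ?_⟩
    · rw [Metric.tendsto_atTop']
      intro e he
      have hlim := tendsto_deficitBound (half_pos he)
      have hlt : (gaussianReal 0 1).real (Set.Icc 0 (e / 2)) < e :=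
        (gaussianReal_real_Icc_le (half_pos he).le).trans_lt (half_lt_self he)
      obtain ⟨N, hN⟩ := eventually_atTop.1 (hlim.eventually_lt_const hlt)
      refine ⟨N, fun n hn => ?_⟩
      have hn0 : 0 < n := (Nat.zero_le N).trans_lt hn
      have h0 : 0 ≤ ⨆ t, D n t := Real.iSup_nonneg fun t => le_max_left _ _
      rw [Real.dist_eq, sub_zero, abs_of_nonneg h0]
      refine lt_of_le_of_lt (Real.iSup_le (fun t => max_le ?_
        (sub_noiseVariance_sqrtBall_le hn0 (half_pos he) t.2)) ?_) (hN n hn.le)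
      all_goals
        unfold deficitBound
        have := Real.pi_pos
        positivity
    · have h := (le_max_right _ _).trans (le_ciSup (hbdd n) ⟨t, ht⟩)
      linarith
  refine ⟨hmain, fun hsens => ?_⟩
  obtain ⟨ε, hε, hbound⟩ := hmain
  -- This `t` makes `e^{-2t} = 1/√2`, hence `θ = π/4`, and the lower bound tends to `1/4 - 1/(4√2) >
  -- 0`.
  have ht : 0 < Real.log 2 / 4 := by have := Real.log_pos one_lt_two; positivity
  have hexp : Real.exp (-2 * (Real.log 2 / 4)) = Real.cos (Real.pi / 4) := by
    rw [Real.cos_pi_div_four, show -2 * (Real.log 2 / 4) = -(Real.log 2 / 2) by ring,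
      Real.exp_neg, Real.exp_half, Real.exp_log two_pos, eq_div_iff two_ne_zero,
      inv_mul_eq_iff_eq_mul₀ (by positivity), Real.mul_self_sqrt two_pos.le]
  have harc : Real.arccos (Real.exp (-2 * (Real.log 2 / 4))) = Real.pi / 4 := by
    rw [hexp, Real.arccos_cos (by have := Real.pi_pos; positivity)
      (by linarith [Real.pi_pos])]
  have hlim := le_of_tendsto_of_tendsto (hε.const_sub
    (1 / 4 - Real.pi / 4 / (Real.sqrt 2 * Real.pi))) (hsens _ ht)
    (.of_forall fun n => by simpa only [harc] using hbound n _ ht)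
  have hs : 1 < Real.sqrt 2 := Real.lt_sqrt_of_sq_lt (by norm_num)
  have hlt : Real.pi / 4 / (Real.sqrt 2 * Real.pi) < 1 / 4 := by
    rw [div_lt_iff₀ (by have := Real.pi_pos; positivity)]
    nlinarith [Real.pi_pos]
  linarith
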